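/- Let $(\Omega,\mathcal F,\mu)$ be a probability space and let $\theta:\Omega\to\Omega$ be an invertible (with measurable inverse) ergodic $\mu$-preserving transformation. Let $\mathbb M_d$ be the algebra of complex $d\times d$ matrices. A quantum channel is a completely positive, trace-preserving linear map $\mathbb M_d\to\mathbb M_d$. Let $\phi$ be a random quantum channel, i.e. a measurable map $\omega\mapsto\phi_\omega$ from $\Omega$ to the quantum channels on $\mathbb M_d$. The pair $(\theta,\phi)$ is called an ergodic quantum process. A projection in $\mathbb M_d$ is a nonzero matrix $p$ with $p=p^2=p^*$; a random projection is a measurable map $p:\Omega\to\mathbb M_d$ that is a.e. a projection. Assume that the process is irreducible: the only random projection $p$ (up to a.e. equality) with $\phi_{\theta(\omega)}(p_\omega\mathbb M_dp_\omega)\subseteq p_{\theta(\omega)}\mathbb M_dp_{\theta(\omega)}$ for a.e. $\omega$ is $p=\mathbb I$. Let $\varrho:\Omega\to\mathbb M_d$ be its (unique) steady state, i.e. the random density matrix (positive semidefinite with trace $1$ a.e.) with $\phi_{\theta(\omega)}(\varrho_\omega)=\varrho_{\theta(\omega)}$ for a.e. $\omega$. Let $\alpha$ be a peripheral eigenvalue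 of the process: $\alpha\in\mathbb C$, $|\alpha|=1$, and there is a measurable $x:\Omega\to\mathbb M_d$, not a.e. zero, with $\phi_{\theta(\omega)}(x_\omega)=\alpha x_{\theta(\omega)}$ for a.e. $\omega$. Let $\Lambda_\theta$ be the set of $\beta\in\mathbb C$ for which there is a measurable $f:\Omega\to\mathbb C$, not a.e. zero, with $f\circ\theta=\beta f$ a.e. Let $N_\alpha$ be the least integer $n\ge1$ with $\alpha^n\in\Lambda_\theta$. Then $N_\alpha$ is finite (i.e. such an $n$ exists), and there are random projections $p_k:\Omega\to\mathbb M_d$, $k\in\mathbb Z/N_\alpha\mathbb Z$, and a measurable map $\varsigma:\Omega\to\mathbb Z/N_\alpha\mathbb Z$ such that for a.e. $\omega\in\Omega$: (i) $\sum_{k}p_{k;\omega}=\mathbb I$ and $p_{k;\omega}p_{j;\omega}=0$ for $k\ne j$ (so that $\{p_k\}$ is a random partition of unity); (ii) $\phi_{\theta(\omega)}\big(p_{k;\omega}\mathbb M_dp_{k;\omega}\big)\subseteq p_{k-\varsigma(\omega);\theta(\omega)}\,\mathbb M_d\,p_{k-\varsigma(\omega);\theta(\omega)}$ for all $k\in\mathbb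 Z/N_\alpha\mathbb Z$; (iii) $\displaystyle\varrho_\omega=\frac1{N_\alpha}\sum_{k\in\mathbb Z/N_\alpha\mathbb Z}\frac{p_{k;\omega}\varrho_\omega p_{k;\omega}}{\operatorname{Tr}(p_{k;\omega}\varrho_\omega p_{k;\omega})}$. -/

import Mathlib

open MeasureTheory Matrix
open scoped ComplexOrder

namespace QuantumProcess

/-- The algebra `M_d` of `d × d` complex matrices. -/
abbrev Mat (d : ℕ) : Type := Matrix (Fin d) (Fin d) ℂ

/-- A projection in `M_d`: a nonzero matrix `p` with `p = p ^ 2 = p^*`. -/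
def IsProj {d : ℕ} (p : Mat d) : Prop :=
  p ≠ 0 ∧ IsStarProjection p

/-- A density matrix: positive semidefinite with trace one. -/
def IsDensity {d : ℕ} (ρ : Mat d) : Prop :=
  ρ.PosSemidef ∧ ρ.trace = 1

/-- Complete positivity: for every `k`, applying `ψ` to each entry of a `k × k` matrix over `M_d`
(that is, applying `ψ ⊗ id` on `M_d ⊗ M_k`) preserves positive semidefiniteness. -/
def IsCompletelyPositive {d : ℕ} (ψ : Mat d →ₗ[ℂ] Mat d) : Prop :=
  ∀ (k : ℕ) (M : Matrix (Fin k) (Fin k) (Mat d)),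
    (Matrix.comp (Fin k) (Fin k) (Fin d) (Fin d) ℂ M).PosSemidef →
      (Matrix.comp (Fin k) (Fin k) (Fin d) (Fin d) ℂ (M.map ψ)).PosSemidef

/-- A quantum channel: a completely positive and trace preserving linear map on `M_d`. -/
def IsQuantumChannel {d : ℕ} (ψ : Mat d →ₗ[ℂ] Mat d) : Prop :=
  IsCompletelyPositive ψ ∧ ∀ a : Mat d, (ψ a).trace = a.trace

/-- The corner `p M_d p`. -/
def corner {d : ℕ} (p : Mat d) : Set (Mat d) :=
  {x | ∃ a : Mat d, x = p * a * p}

/-- A finite family of projections is a partition of unity if it sums to the identity and its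
members are pairwise orthogonal. -/
def IsPartitionOfUnity {d : ℕ} {I : Type*} [Fintype I] (p : I → Mat d) : Prop :=
  (∀ k, IsProj (p k)) ∧ ∑ k, p k = 1 ∧ ∀ k j, k ≠ j → p k * p j = 0

section Random

variable {Ω : Type*} [MeasurableSpace Ω]

/-- A random matrix: a (Borel, i.e. entrywise) measurable map into `M_d`. -/
def IsRandomMatrix {d : ℕ} (a : Ω → Mat d) : Prop :=
  ∀ i j, Measurable fun ω => a ω i j

/-- A random projection: a random matrix that is almost surely a projection. -/
def IsRandomProjection {d : ℕ} (μ : Measure Ω) (p : Ω → Mat d) : Prop :=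
  IsRandomMatrix p ∧ ∀ᵐ ω ∂μ, IsProj (p ω)

/-- A random density matrix. -/
def IsRandomDensity {d : ℕ} (μ : Measure Ω) (ρ : Ω → Mat d) : Prop :=
  IsRandomMatrix ρ ∧ ∀ᵐ ω ∂μ, IsDensity (ρ ω)

/-- A random quantum channel: a measurable map into the linear maps on `M_d` (measurability is
that of all matrix coefficients) whose values are almost surely quantum channels. -/
def IsRandomChannel {d : ℕ} (μ : Measure Ω) (φ : Ω → Mat d →ₗ[ℂ] Mat d) : Prop :=
  (∀ a : Mat d, IsRandomMatrix fun ω => φ ω a) ∧ ∀ᵐ ω ∂μ, IsQuantumChannel (φ ω)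

/-- A finite family of random projections that is almost surely a partition of unity. -/
def IsRandomPartitionOfUnity {d : ℕ} {I : Type*} [Fintype I] (μ : Measure Ω)
    (p : I → Ω → Mat d) : Prop :=
  (∀ k, IsRandomProjection μ (p k)) ∧ ∀ᵐ ω ∂μ, IsPartitionOfUnity fun k => p k ω

/-- The pair `(θ, φ)` defines an ergodic quantum process: `θ` is an invertible (bimeasurable)
ergodic measure preserving transformation and `φ` is a random quantum channel. -/
def IsErgodicQuantumProcess {d : ℕ} (μ : Measure Ω) (θ : Ω ≃ᵐ Ω)
    (φ : Ω → Mat d →ₗ[ℂ] Mat d) : Prop :=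
  Ergodic θ μ ∧ IsRandomChannel μ φ

/-- The random projection `p` reduces the process: `φ_{θ(ω)} (p_ω M_d p_ω) ⊆ p_{θ(ω)} M_d p_{θ(ω)}`
for almost every `ω`. -/
def Reduces {d : ℕ} (μ : Measure Ω) (θ : Ω ≃ᵐ Ω) (φ : Ω → Mat d →ₗ[ℂ] Mat d)
    (p : Ω → Mat d) : Prop :=
  ∀ᵐ ω ∂μ, Set.MapsTo (φ (θ ω)) (corner (p ω)) (corner (p (θ ω)))

/-- The process is irreducible if the identity is the only random projection that reduces it. -/
def IsIrreducibleProcess {d : ℕ} (μ : Measure Ω) (θ : Ω ≃ᵐ Ω)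
    (φ : Ω → Mat d →ₗ[ℂ] Mat d) : Prop :=
  ∀ p : Ω → Mat d, IsRandomProjection μ p → Reduces μ θ φ p → ∀ᵐ ω ∂μ, p ω = 1

/-- `ϱ` is a steady state: a random density matrix with `φ_{θ(ω)} (ϱ_ω) = ϱ_{θ(ω)}` for almost
every `ω`. -/
def IsSteadyState {d : ℕ} (μ : Measure Ω) (θ : Ω ≃ᵐ Ω) (φ : Ω → Mat d →ₗ[ℂ] Mat d)
    (ϱ : Ω → Mat d) : Prop :=
  IsRandomDensity μ ϱ ∧ ∀ᵐ ω ∂μ, φ (θ ω) (ϱ ω) = ϱ (θ ω)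

/-- The eigenvalues of the process: those `α` for which there is a random matrix `x`, not almost
surely zero, with `φ_{θ(ω)} (x_ω) = α x_{θ(ω)}` for almost every `ω`. -/
def processEigenvalues {d : ℕ} (μ : Measure Ω) (θ : Ω ≃ᵐ Ω)
    (φ : Ω → Mat d →ₗ[ℂ] Mat d) : Set ℂ :=
  {α | ∃ x : Ω → Mat d, IsRandomMatrix x ∧ (¬ ∀ᵐ ω ∂μ, x ω = 0) ∧
    ∀ᵐ ω ∂μ, φ (θ ω) (x ω) = α • x (θ ω)}

/-- The peripheral eigenvalues of the process: the eigenvalues of modulus one. -/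
def peripheralEigenvalues {d : ℕ} (μ : Measure Ω) (θ : Ω ≃ᵐ Ω)
    (φ : Ω → Mat d →ₗ[ℂ] Mat d) : Set ℂ :=
  {α | α ∈ processEigenvalues μ θ φ ∧ ‖α‖ = 1}

/-- The eigenvalues of `θ`: those `β` for which there is a measurable `f : Ω → ℂ`, not almost
surely zero, with `f ∘ θ = β f` almost surely. -/
def thetaEigenvalues (μ : Measure Ω) (θ : Ω ≃ᵐ Ω) : Set ℂ :=
  {β | ∃ f : Ω → ℂ, Measurable f ∧ (¬ ∀ᵐ ω ∂μ, f ω = 0) ∧ ∀ᵐ ω ∂μ, f (θ ω) = β * f ω}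

/-- `N` is the (finite) number `N_α`, the least positive integer `n` such that `α ^ n` is an
eigenvalue of `θ`. -/
def IsPeriod (μ : Measure Ω) (θ : Ω ≃ᵐ Ω) (α : ℂ) (N : ℕ) : Prop :=
  IsLeast {n : ℕ | 0 < n ∧ α ^ n ∈ thetaEigenvalues μ θ} N

end Random

end QuantumProcess

open QuantumProcess

namespace QuantumProcess

/-! ### Matrix preliminaries -/

/-! A channel contracts the trace norm. For a peripheral eigenvector `x`, the function `Tr |x|`
therefore decreases along orbits, and on a finite measure space it must be invariant. Equality in
the contraction makes `|x|` a fixed point (`IsEigen.fixed_absMat`). Under irreducibility a positive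
fixed point has full support or vanishes, so every fixed point is a multiple of the invertible state
`ϱ` (`IsEigen.eq_trace_smul`). Hence `x = c u ϱ` with `u` unitary, and the equality case, read on
Kraus operators, says `K u = α u' K` with `u' = u ∘ θ`. So `u` passes through the channel at the
cost of a factor `α` (`exists_random_unitary`).

The traces `Tr (u ^ n ϱ)` link `α` to `θ`: a nonzero one yields an eigenfunction of `θ` for `α ^ n`,
and Cayley-Hamilton provides a positive `n` with nonzero trace. Conversely, if `α ^ n` is an
eigenvalue of `θ`, then `u ^ n` is scalar. With `N` the period, `u ^ N = f • 1` while the traces for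
`0 < n < N` vanish. Dividing `u` by a measurable `N`-th root of `f` gives `v` with `v ^ N = 1`,
whose spectral projections each have `ϱ`-weight `1 / N`. The channel moves `v` with an `N`-th root
of unity as multiplier, hence shifts the projections cyclically. -/

lemma exists_unitary_diagonal {d : ℕ} {A : Mat d} (hA : A.PosSemidef) :
    ∃ (U : Mat d) (D : Fin d → ℝ), Uᴴ * U = 1 ∧ U * Uᴴ = 1 ∧ (∀ i, 0 ≤ D i) ∧
      A = U * diagonal (fun i => (D i : ℂ)) * Uᴴ := by
  refine ⟨hA.1.eigenvectorUnitary, hA.1.eigenvalues, ?_, ?_, hA.eigenvalues_nonneg, ?_⟩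
  · exact Unitary.coe_star_mul_self _
  · exact Unitary.coe_mul_star_self _
  · exact hA.1.spectral_theorem

lemma posSemidef_conj_diagonal {d : ℕ} (U : Mat d) {D : Fin d → ℝ} (hD : ∀ i, 0 ≤ D i) :
    (U * diagonal (fun i => (D i : ℂ)) * Uᴴ).PosSemidef := by
  refine PosSemidef.mul_mul_conjTranspose_same ?_ U
  rw [posSemidef_diagonal_iff]
  intro i
  exact_mod_cast hD i

/-- A matrix whose columns are orthogonal is a unitary matrix times a nonnegative diagonal one. -/
lemma exists_unitary_mul_diagonal {d : ℕ} {Z : Mat d} {D : Fin d → ℝ} (hD : ∀ i, 0 ≤ D i)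
    (hZ : Zᴴ * Z = diagonal fun i => (D i : ℂ)) :
    ∃ W : Mat d, Wᴴ * W = 1 ∧ Z = W * diagonal fun i => ((√(D i) : ℝ) : ℂ) := by
  have hinner (i j : Fin d) : inner ℂ (WithLp.toLp 2 (fun k => Z k i) : EuclideanSpace ℂ (Fin d))
      (WithLp.toLp 2 (fun k => Z k j)) = if i = j then (D i : ℂ) else 0 := by
    have := congrFun (congrFun hZ i) j
    rw [diagonal_apply, mul_apply] at this
    rw [← this, EuclideanSpace.inner_eq_star_dotProduct]
    simp [dotProduct, mul_comm]
  set v : Fin d → EuclideanSpace ℂ (Fin d) := fun j =>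
    (((√(D j))⁻¹ : ℝ) : ℂ) • WithLp.toLp 2 (fun k => Z k j) with hv
  set s : Set (Fin d) := {j | D j ≠ 0}
  have hon : Orthonormal ℂ (s.domRestrict v) := by
    rw [orthonormal_iff_ite]
    rintro ⟨i, hi⟩ ⟨j, hj⟩
    simp only [Set.domRestrict_apply, hv, inner_smul_left, inner_smul_right, hinner,
      Complex.conj_ofReal, Subtype.mk.injEq]
    split_ifs with h
    · subst h
      have h0 : √(D i) ≠ 0 := (Real.sqrt_pos.2 (lt_of_le_of_ne (hD i) (Ne.symm hi))).ne'
      have h1 : D i = √(D i) * √(D i) := (Real.mul_self_sqrt (hD i)).symm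
      rw [← Complex.ofReal_mul, ← Complex.ofReal_mul]
      norm_cast
      nth_rewrite 3 [h1]
      field_simp
    · simp
  -- The basis vectors filling the indices with `D j = 0` are arbitrary: they are multiplied by
  -- `√0`.
  obtain ⟨b, hb⟩ := Orthonormal.exists_orthonormalBasis_extension_of_card_eq
    (by simp) hon
  refine ⟨Matrix.of fun i j => b j i, ?_, ?_⟩
  · ext i j
    have := orthonormal_iff_ite.1 b.orthonormal i j
    rw [EuclideanSpace.inner_eq_star_dotProduct] at this
    rw [one_apply, ← this]
    simp [dotProduct, mul_apply, mul_comm]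
  · ext i j
    rw [mul_diagonal, of_apply]
    by_cases hj : D j = 0
    · have h0 : (WithLp.toLp 2 (fun k => Z k j) : EuclideanSpace ℂ (Fin d)) = 0 := by
        rw [← inner_self_eq_zero (𝕜 := ℂ), hinner]
        simp [hj]
      have := congrArg (fun w : EuclideanSpace ℂ (Fin d) => w i) h0
      simp only [PiLp.zero_apply] at this
      simp [hj, this]
    · rw [hb j hj]
      have h0 : ((√(D j) : ℝ) : ℂ) ≠ 0 := by
        exact_mod_cast (Real.sqrt_pos.2 (lt_of_le_of_ne (hD j) (Ne.symm hj))).ne'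
      simp only [hv, PiLp.smul_apply, smul_eq_mul, Complex.ofReal_inv]
      field_simp

/-! ### Absolute value, polar decomposition and support. -/

section Abs

open scoped Matrix.Norms.L2Operator MatrixOrder

/-- The absolute value `(x^* x)^{1/2}` of a matrix. -/
noncomputable def absMat {d : ℕ} (x : Mat d) : Mat d := CFC.abs x

lemma absMat_posSemidef {d : ℕ} (x : Mat d) : (absMat x).PosSemidef :=
  nonneg_iff_posSemidef.1 (CFC.abs_nonneg x)

lemma absMat_mul_self {d : ℕ} (x : Mat d) : absMat x * absMat x = xᴴ * x :=
  CFC.abs_mul_abs x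

lemma absMat_eq {d : ℕ} {x h : Mat d} (hh : h.PosSemidef) (hx : h * h = xᴴ * x) :
    absMat x = h :=
  CFC.sqrt_unique hx (nonneg_iff_posSemidef.2 hh)

lemma continuous_absMat (d : ℕ) : Continuous (absMat : Mat d → Mat d) :=
  CFC.continuous_abs

lemma commute_absMat_self {d : ℕ} {x : Mat d} (hx : x.IsHermitian) : absMat x * x = x * absMat x :=
  CFC.commute_abs_self x hx.isSelfAdjoint.isStarNormal

lemma absMat_add_self_posSemidef {d : ℕ} {x : Mat d} (hx : x.IsHermitian) :
    (absMat x + x).PosSemidef := by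
  have h : absMat x + x = 2 • x⁺ := CFC.abs_add_self x hx.isSelfAdjoint
  rw [h, ← nonneg_iff_posSemidef]
  exact nsmul_nonneg (CFC.posPart_nonneg x) 2

end Abs

/-- Polar decomposition of square matrices. -/
lemma exists_polar {d : ℕ} (x : Mat d) : ∃ u : Mat d, uᴴ * u = 1 ∧ x = u * absMat x := by
  obtain ⟨V, D, hV, hV', hD, hA⟩ := exists_unitary_diagonal (posSemidef_conjTranspose_mul_self x)
  -- `V` diagonalizes `xᴴ * x`, so the columns of `x * V` are orthogonal. This gives a full unitary
  -- even for singular `x`.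
  have hZ : (x * V)ᴴ * (x * V) = diagonal fun i => (D i : ℂ) := by
    calc (x * V)ᴴ * (x * V) = Vᴴ * (xᴴ * x) * V := by
          rw [conjTranspose_mul]; simp only [Matrix.mul_assoc]
      _ = (Vᴴ * V) * diagonal (fun i => (D i : ℂ)) * (Vᴴ * V) := by
          rw [hA]; simp only [Matrix.mul_assoc]
      _ = _ := by rw [hV, Matrix.one_mul, Matrix.mul_one]
  obtain ⟨W, hW, hZW⟩ := exists_unitary_mul_diagonal hD hZ
  have habs : absMat x = V * diagonal (fun i => ((√(D i) : ℝ) : ℂ)) * Vᴴ := by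
    refine absMat_eq (posSemidef_conj_diagonal V fun i => Real.sqrt_nonneg _) ?_
    calc _ = V * diagonal (fun i => ((√(D i) : ℝ) : ℂ)) * (Vᴴ * V) *
          diagonal (fun i => ((√(D i) : ℝ) : ℂ)) * Vᴴ := by simp only [Matrix.mul_assoc]
      _ = V * (diagonal (fun i => ((√(D i) : ℝ) : ℂ)) *
          diagonal (fun i => ((√(D i) : ℝ) : ℂ))) * Vᴴ := by
          rw [hV, Matrix.mul_one]; simp only [Matrix.mul_assoc]
      _ = xᴴ * x := by
          rw [hA, diagonal_mul_diagonal]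
          congr 3
          ext i
          rw [← Complex.ofReal_mul, Real.mul_self_sqrt (hD i)]
  refine ⟨W * Vᴴ, ?_, ?_⟩
  · calc (W * Vᴴ)ᴴ * (W * Vᴴ) = V * (Wᴴ * W) * Vᴴ := by
          rw [conjTranspose_mul, conjTranspose_conjTranspose]; simp only [Matrix.mul_assoc]
      _ = 1 := by rw [hW, Matrix.mul_one, hV']
  · calc x = (x * V) * Vᴴ := by rw [Matrix.mul_assoc, hV', Matrix.mul_one]
      _ = W * diagonal (fun i => ((√(D i) : ℝ) : ℂ)) * Vᴴ := by rw [hZW]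
      _ = W * (Vᴴ * V) * diagonal (fun i => ((√(D i) : ℝ) : ℂ)) * Vᴴ := by
          rw [hV, Matrix.mul_one]
      _ = _ := by rw [habs]; simp only [Matrix.mul_assoc]

/-- The support projection of a positive semidefinite matrix as a limit of rational functions. -/
lemma exists_support {d : ℕ} {m : Mat d} (hm : m.PosSemidef) :
    ∃ p s : Mat d, IsStarProjection p ∧ p * m = m ∧ p = m * s ∧
      ∀ i j, Filter.Tendsto
        (fun n : ℕ => (m * (m + (((n : ℝ) + 1)⁻¹ : ℂ) • (1 : Mat d))⁻¹) i j) Filter.atTop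
        (nhds (p i j)) := by
  obtain ⟨U, D, hU, hU', hD, hA⟩ := exists_unitary_diagonal hm
  have hconj (f g : Fin d → ℂ) : (U * diagonal f * Uᴴ) * (U * diagonal g * Uᴴ) =
      U * diagonal (fun i => f i * g i) * Uᴴ := by
    calc _ = U * diagonal f * (Uᴴ * U) * diagonal g * Uᴴ := by simp only [Matrix.mul_assoc]
      _ = U * (diagonal f * diagonal g) * Uᴴ := by
          rw [hU, Matrix.mul_one]; simp only [Matrix.mul_assoc]
      _ = _ := by rw [diagonal_mul_diagonal]
  have hone (c : ℂ) : c • (1 : Mat d) = U * diagonal (fun _ => c) * Uᴴ := by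
    have : diagonal (fun _ : Fin d => c) = c • (1 : Mat d) := by
      rw [← diagonal_one, ← diagonal_smul]; congr 1; ext; simp
    rw [this, Matrix.mul_smul, Matrix.smul_mul, Matrix.mul_one, hU']
  have hadd (f g : Fin d → ℂ) : U * diagonal f * Uᴴ + U * diagonal g * Uᴴ =
      U * diagonal (fun i => f i + g i) * Uᴴ := by
    rw [← diagonal_add, Matrix.mul_add, Matrix.add_mul]
  -- Since `0⁻¹ = 0`, the second witness is the pseudo-inverse of `m`.
  refine ⟨U * diagonal (fun i => if D i = 0 then 0 else 1) * Uᴴ,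
    U * diagonal (fun i => ((D i)⁻¹ : ℂ)) * Uᴴ, ⟨?_, ?_⟩, ?_, ?_, ?_⟩
  · rw [IsIdempotentElem, hconj]
    congr 3; ext i; simp
  · rw [IsSelfAdjoint, star_eq_conjTranspose, conjTranspose_mul, conjTranspose_mul,
      conjTranspose_conjTranspose, diagonal_conjTranspose, Matrix.mul_assoc]
    congr 3; ext i; simp [apply_ite]
  · rw [hA, hconj]
    congr 3; ext i; split_ifs with h <;> simp [h]
  · rw [hA, hconj]
    congr 3; ext i; split_ifs with h <;> simp [h]
  · intro i j
    have hinv (n : ℕ) : m * (m + (((n : ℝ) + 1)⁻¹ : ℂ) • (1 : Mat d))⁻¹ =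
        U * diagonal (fun k => (D k : ℂ) * ((D k : ℂ) + (((n : ℝ) + 1)⁻¹ : ℂ))⁻¹) * Uᴴ := by
      have h0 (k : Fin d) : (D k : ℂ) + (((n : ℝ) + 1)⁻¹ : ℂ) ≠ 0 := by
        have : (0 : ℝ) < D k + ((n : ℝ) + 1)⁻¹ := add_pos_of_nonneg_of_pos (hD k) (by positivity)
        exact_mod_cast this.ne'
      rw [inv_eq_right_inv (B := U * diagonal (fun k => ((D k : ℂ) + (((n : ℝ) + 1)⁻¹ : ℂ))⁻¹) * Uᴴ)]
      · conv_lhs => rw [hA]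
        rw [hconj]
      · rw [hone, hA, hadd, hconj, ← one_smul ℂ (1 : Mat d), hone]
        congr 3; ext k
        exact mul_inv_cancel₀ (h0 k)
    have hentry (f : Fin d → ℂ) :
        (U * diagonal f * Uᴴ) i j = ∑ k, U i k * f k * Uᴴ k j := by
      rw [mul_apply]
      exact Finset.sum_congr rfl fun k _ => by rw [mul_diagonal]
    rw [hentry]
    refine Filter.Tendsto.congr (fun n => (congrFun (congrFun (hinv n) i) j).symm) ?_
    refine Filter.Tendsto.congr (fun n => (hentry _).symm) ?_
    refine tendsto_finsetSum _ fun k _ => Filter.Tendsto.mul_const _ (Filter.Tendsto.const_mul _ ?_)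
    have hlim : Filter.Tendsto (fun n : ℕ => (((n : ℝ) + 1)⁻¹ : ℂ)) Filter.atTop (nhds 0) := by
      have := tendsto_one_div_add_atTop_nhds_zero_nat (𝕜 := ℂ)
      simpa using this
    split_ifs with h
    · simp [h]
    · have h0 : (D k : ℂ) ≠ 0 := by exact_mod_cast h
      have := ((hlim.const_add (D k : ℂ)).inv₀ (by simpa using h0)).const_mul (D k : ℂ)
      simpa [h0] using this

/-! ### Kraus operators -/

section Factor

open scoped Matrix.Norms.L2Operator MatrixOrder

lemma exists_eq_conjTranspose_mul_self {n : Type*} [Fintype n] [DecidableEq n] {A : Matrix n n ℂ}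
    (hA : A.PosSemidef) : ∃ B : Matrix n n ℂ, A = Bᴴ * B :=
  CStarAlgebra.nonneg_iff_eq_star_mul_self.1 (nonneg_iff_posSemidef.2 hA)

end Factor

lemma mul_eq_zero_of_conj_eq_zero {d : ℕ} {h T : Mat d} (hh : h.PosSemidef)
    (hT : T * h * Tᴴ = 0) : T * h = 0 := by
  obtain ⟨B, rfl⟩ := exists_eq_conjTranspose_mul_self hh
  have : (T * Bᴴ) * (T * Bᴴ)ᴴ = 0 := by
    rw [conjTranspose_mul, conjTranspose_conjTranspose, ← hT]
    simp only [Matrix.mul_assoc]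
  rw [self_mul_conjTranspose_eq_zero] at this
  rw [← Matrix.mul_assoc, this, Matrix.zero_mul]

/-- A vanishing sum of nonnegative traces kills each positive term. This turns equalities of traces
into identities for individual Kraus operators. -/
lemma mul_eq_zero_of_sum_trace_eq_zero {d : ℕ} {ι : Type*} [Fintype ι] {h : Mat d}
    (hh : h.PosSemidef) {T : ι → Mat d} (hT : ∑ r, (T r * h * (T r)ᴴ).trace = 0) (r : ι) :
    T r * h = 0 := by
  have hps (r : ι) : (T r * h * (T r)ᴴ).PosSemidef := hh.mul_mul_conjTranspose_same _
  have := (Finset.sum_eq_zero_iff_of_nonneg fun r _ => (hps r).trace_nonneg).1 hT r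
    (Finset.mem_univ r)
  exact mul_eq_zero_of_conj_eq_zero hh ((hps r).trace_eq_zero_iff.1 this)

/-- Existence of Kraus operators for a completely positive map. -/
theorem exists_kraus {d : ℕ} {ψ : Mat d →ₗ[ℂ] Mat d} (hψ : IsCompletelyPositive ψ) :
    ∃ K : Fin d × Fin d → Mat d, ∀ a, ψ a = ∑ r, K r * a * (K r)ᴴ := by
  -- The block matrix of matrix units has rank one and is positive. Its image under `ψ` is the Choi
  -- matrix, and a factorization `Bᴴ * B` of the latter yields the Kraus operators.
  have h1 : (Matrix.comp (Fin d) (Fin d) (Fin d) (Fin d) ℂ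
      (Matrix.of fun i j => Matrix.single i j (1 : ℂ))).PosSemidef := by
    convert posSemidef_vecMulVec_self_star
      (fun q : Fin d × Fin d => if q.1 = q.2 then (1 : ℂ) else 0) using 1
    ext ⟨i, a⟩ ⟨j, b⟩
    simp only [Matrix.comp_apply, of_apply, single_apply, vecMulVec_apply, Pi.star_apply]
    split_ifs <;> simp_all
  obtain ⟨B, hB⟩ := exists_eq_conjTranspose_mul_self (hψ d _ h1)
  have hE (i j x y : Fin d) :
      ψ (Matrix.single i j 1) x y = ∑ r, star (B r (i, x)) * B r (j, y) := by
    have := congrFun (congrFun hB (i, x)) (j, y)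
    rw [mul_apply] at this
    simpa using this
  refine ⟨fun r => Matrix.of fun x i => star (B r (i, x)), fun a => ?_⟩
  ext x y
  conv_lhs => rw [matrix_eq_sum_single a]
  simp only [map_sum, Matrix.sum_apply, mul_apply, of_apply, conjTranspose_apply, star_star]
  have hs (i j : Fin d) : ψ (Matrix.single i j (a i j)) x y =
      ∑ r, star (B r (i, x)) * a i j * B r (j, y) := by
    have : Matrix.single i j (a i j) = a i j • Matrix.single i j (1 : ℂ) := by simp
    rw [this, map_smul, Matrix.smul_apply, hE, smul_eq_mul, Finset.mul_sum]
    exact Finset.sum_congr rfl fun r _ => by ring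
  simp only [hs, Finset.sum_mul]
  rw [Finset.sum_comm]
  simp_rw [Finset.sum_comm (s := (Finset.univ : Finset (Fin d)))
    (t := (Finset.univ : Finset (Fin d × Fin d)))]

/-- `K` is a family of Kraus operators for `ψ`. -/
def IsKraus {d : ℕ} {ι : Type*} [Fintype ι] (ψ : Mat d →ₗ[ℂ] Mat d) (K : ι → Mat d) : Prop :=
  ∀ a, ψ a = ∑ r, K r * a * (K r)ᴴ

/-! ### Trace-norm contraction and its equality case. -/

section Kraus

variable {d : ℕ} {ι : Type*} [Fintype ι] {ψ : Mat d →ₗ[ℂ] Mat d} {K : ι → Mat d}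

lemma IsKraus.map_conjTranspose (hK : IsKraus ψ K) (a : Mat d) : ψ aᴴ = (ψ a)ᴴ := by
  rw [hK, hK, conjTranspose_sum]
  refine Finset.sum_congr rfl fun r _ => ?_
  rw [conjTranspose_mul, conjTranspose_mul, conjTranspose_conjTranspose, Matrix.mul_assoc]

lemma trace_unitary_conj {u : Mat d} (hu : uᴴ * u = 1) (a : Mat d) :
    (u * a * uᴴ).trace = a.trace := by
  rw [trace_mul_comm, ← Matrix.mul_assoc, hu, Matrix.one_mul]

/-- The defect of a channel in intertwining two polar decompositions. -/
lemma IsKraus.sum_trace_defect (hK : IsKraus ψ K) (htr : ∀ a, (ψ a).trace = a.trace)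
    {α : ℂ} (hα : ‖α‖ = 1) {w h u k : Mat d} (hw : wᴴ * w = 1) (hu : uᴴ * u = 1)
    (hh : h.IsHermitian) (hk : k.IsHermitian) (hψ : ψ (w * h) = α • (u * k)) :
    ∑ r, ((K r * w - α • (u * K r)) * h * (K r * w - α • (u * K r))ᴴ).trace =
      2 * (h.trace - k.trace) := by
  have hαα : star α * α = 1 := by
    rw [Complex.star_def, Complex.conj_mul', hα]; simp
  -- After summation the two square terms have trace `h.trace` each, by trace preservation. The two
  -- cross terms have trace `k.trace` each, by `hψ` and its adjoint.
  have hterm (r : ι) : (K r * w - α • (u * K r)) * h * (K r * w - α • (u * K r))ᴴ =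
      K r * (w * h * wᴴ) * (K r)ᴴ - star α • (K r * (w * h) * (K r)ᴴ * uᴴ)
        - α • (u * (K r * (h * wᴴ) * (K r)ᴴ)) + (star α * α) • (u * (K r * h * (K r)ᴴ) * uᴴ) := by
    simp only [conjTranspose_sub, conjTranspose_smul, conjTranspose_mul, Matrix.sub_mul,
      Matrix.mul_sub, Matrix.smul_mul, Matrix.mul_smul, Matrix.mul_assoc]
    module
  have hsum : ∑ r, (K r * w - α • (u * K r)) * h * (K r * w - α • (u * K r))ᴴ =
      ψ (w * h * wᴴ) - star α • (ψ (w * h) * uᴴ) - α • (u * ψ (h * wᴴ)) +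
        u * ψ h * uᴴ := by
    simp only [hterm, hαα, one_smul, hK _, Finset.sum_add_distrib, Finset.sum_sub_distrib,
      Finset.smul_sum, Finset.sum_mul, Finset.mul_sum]
  have hadj : ψ (h * wᴴ) = star α • (k * uᴴ) := by
    have : h * wᴴ = (w * h)ᴴ := by rw [conjTranspose_mul, hh.eq]
    rw [this, hK.map_conjTranspose, hψ, conjTranspose_smul, conjTranspose_mul, hk.eq]
  rw [← trace_sum, hsum, hψ, hadj]
  simp only [trace_add, trace_sub, Matrix.smul_mul, Matrix.mul_smul, smul_smul, trace_smul, htr,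
    trace_unitary_conj hw, trace_unitary_conj hu, ← Matrix.mul_assoc, smul_eq_mul, hαα,
    mul_comm α (star α)]
  ring

lemma IsKraus.trace_abs_le (hK : IsKraus ψ K) (htr : ∀ a, (ψ a).trace = a.trace)
    {α : ℂ} (hα : ‖α‖ = 1) {x y : Mat d} (hψ : ψ x = α • y) :
    (absMat y).trace ≤ (absMat x).trace := by
  obtain ⟨w, hw, hx⟩ := exists_polar x
  obtain ⟨u, hu, hy⟩ := exists_polar y
  have h1 := hK.sum_trace_defect htr hα hw hu (absMat_posSemidef x).1 (absMat_posSemidef y).1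
    (by rw [← hx, ← hy, hψ])
  have h2 : (0 : ℂ) ≤ 2 * ((absMat x).trace - (absMat y).trace) := by
    rw [← h1]
    exact Finset.sum_nonneg fun r _ =>
      ((absMat_posSemidef x).mul_mul_conjTranspose_same _).trace_nonneg
  rw [← sub_nonneg]
  have := mul_nonneg (by positivity : (0 : ℂ) ≤ 2⁻¹) h2
  rwa [inv_mul_cancel_left₀ (by norm_num : (2 : ℂ) ≠ 0)] at this

/-- Equal traces annihilate the defect, so `K r * x = α • (u * K r * absMat x)`. Multiplying by `(K
r)ᴴ` and summing gives `u * absMat y = u * ψ (absMat x)`, and the unitary cancels. -/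
lemma IsKraus.map_absMat (hK : IsKraus ψ K) (htr : ∀ a, (ψ a).trace = a.trace)
    {α : ℂ} (hα : ‖α‖ = 1) {x y : Mat d} (hψ : ψ x = α • y)
    (hxy : (absMat y).trace = (absMat x).trace) : ψ (absMat x) = absMat y := by
  obtain ⟨w, hw, hx⟩ := exists_polar x
  obtain ⟨u, hu, hy⟩ := exists_polar y
  have h1 := hK.sum_trace_defect htr hα hw hu (absMat_posSemidef x).1 (absMat_posSemidef y).1
    (by rw [← hx, ← hy, hψ])
  rw [hxy, sub_self, mul_zero] at h1
  have hα0 : α ≠ 0 := by rintro rfl; simp at hα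
  have h2 (r : ι) : K r * x * (K r)ᴴ = α • (u * (K r * absMat x * (K r)ᴴ)) := by
    have := mul_eq_zero_of_sum_trace_eq_zero (absMat_posSemidef x) h1 r
    rw [Matrix.sub_mul, sub_eq_zero, Matrix.mul_assoc, ← hx] at this
    rw [this]
    simp only [Matrix.smul_mul, Matrix.mul_assoc]
  have h3 : α • (u * absMat y) = α • (u * ψ (absMat x)) := by
    rw [← hy, ← hψ, hK, hK (absMat x), Finset.mul_sum, Finset.smul_sum]
    exact Finset.sum_congr rfl fun r _ => h2 r
  have h4 := congrArg (uᴴ * ·) (smul_right_injective _ hα0 h3)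
  simpa only [← Matrix.mul_assoc, hu, Matrix.one_mul] using h4.symm

/-- A channel that respects the polar decompositions of faithful elements intertwines their
unitary parts. -/
lemma IsKraus.map_unitary_mul (hK : IsKraus ψ K) (htr : ∀ a, (ψ a).trace = a.trace)
    {α : ℂ} (hα : ‖α‖ = 1) {w h u k : Mat d} (hw : wᴴ * w = 1) (hu : uᴴ * u = 1)
    (hh : h.PosSemidef) (hk : k.IsHermitian) (hunit : IsUnit h) (hψ : ψ (w * h) = α • (u * k))
    (hhk : h.trace = k.trace) (a : Mat d) : ψ (w * a) = α • (u * ψ a) := by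
  have h1 := hK.sum_trace_defect htr hα hw hu hh.1 hk hψ
  rw [hhk, sub_self, mul_zero] at h1
  have h2 (r : ι) : K r * w = α • (u * K r) := by
    have := mul_eq_zero_of_sum_trace_eq_zero hh h1 r
    exact sub_eq_zero.1 (hunit.mul_left_eq_zero.1 this)
  rw [hK, hK a, Finset.mul_sum, Finset.smul_sum]
  refine Finset.sum_congr rfl fun r _ => ?_
  rw [← Matrix.mul_assoc, h2]
  simp only [Matrix.smul_mul, Matrix.mul_assoc]

/-- The support of a positive semidefinite matrix is mapped into that of its image. -/
lemma IsKraus.mapsTo_corner (hK : IsKraus ψ K) {m p s q : Mat d} (hm : m.PosSemidef)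
    (hps : p = m * s) (hp : IsStarProjection p) (hq : IsStarProjection q)
    (hqm : q * ψ m = ψ m) : Set.MapsTo ψ (corner p) (corner q) := by
  -- Compressing `ψ m` by `1 - q` gives zero, so `(1 - q) * K r` kills `m`, and then `p = m * s`.
  have h0 : ∑ r, (((1 - q) * K r) * m * ((1 - q) * K r)ᴴ).trace = 0 := by
    rw [← trace_sum]
    have : ∑ r, ((1 - q) * K r) * m * ((1 - q) * K r)ᴴ = (1 - q) * ψ m * (1 - q)ᴴ := by
      rw [hK, Finset.mul_sum, Finset.sum_mul]
      refine Finset.sum_congr rfl fun r _ => ?_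
      rw [conjTranspose_mul]
      simp only [Matrix.mul_assoc]
    rw [this, Matrix.sub_mul, Matrix.one_mul, hqm, sub_self, Matrix.zero_mul, trace_zero]
  have h1 (r : ι) : K r * p = q * (K r * p) := by
    have := mul_eq_zero_of_sum_trace_eq_zero hm h0 r
    have h2 : (1 - q) * (K r * p) = 0 := by
      rw [hps, ← Matrix.mul_assoc, ← Matrix.mul_assoc, this, Matrix.zero_mul]
    rwa [Matrix.sub_mul, Matrix.one_mul, sub_eq_zero] at h2
  have hp' : pᴴ = p := hp.isSelfAdjoint
  have hq' : qᴴ = q := hq.isSelfAdjoint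
  have h3 (r : ι) : p * (K r)ᴴ = p * (K r)ᴴ * q := by
    have := congrArg conjTranspose (h1 r)
    simpa only [conjTranspose_mul, hp', hq'] using this
  rintro _ ⟨a, rfl⟩
  refine ⟨ψ (p * a * p), ?_⟩
  rw [hK, Finset.mul_sum, Finset.sum_mul]
  refine Finset.sum_congr rfl fun r _ => ?_
  calc K r * (p * a * p) * (K r)ᴴ = (K r * p) * a * (p * (K r)ᴴ) := by
        simp only [Matrix.mul_assoc]
    _ = (q * (K r * p)) * a * (p * (K r)ᴴ * q) := by rw [← h1, ← h3]
    _ = _ := by simp only [Matrix.mul_assoc]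

end Kraus

lemma IsQuantumChannel.exists_isKraus {d : ℕ} {ψ : Mat d →ₗ[ℂ] Mat d} (hψ : IsQuantumChannel ψ) :
    ∃ K : Fin d × Fin d → Mat d, IsKraus ψ K :=
  exists_kraus hψ.1

/-! ### Random matrices -/

section RandomMatrix

variable {Ω : Type*} [MeasurableSpace Ω] {d : ℕ} {a b : Ω → Mat d}

lemma IsRandomMatrix.measurable_comp (ha : IsRandomMatrix a) {F : Mat d → ℂ} (hF : Continuous F) :
    Measurable fun ω => F (a ω) := by
  have h1 : Measurable fun ω => (fun i j => a ω i j : Fin d → Fin d → ℂ) :=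
    measurable_pi_iff.2 fun i => measurable_pi_iff.2 fun j => ha i j
  have h2 : Measurable (fun m : Fin d → Fin d → ℂ => F (Matrix.of m)) :=
    Continuous.measurable (show Continuous (fun m : Fin d → Fin d → ℂ => F (Matrix.of m)) from hF)
  exact h2.comp h1

lemma IsRandomMatrix.comp_continuous (ha : IsRandomMatrix a) {F : Mat d → Mat d}
    (hF : Continuous F) : IsRandomMatrix fun ω => F (a ω) :=
  fun i j => ha.measurable_comp (hF.matrix_elem i j)

lemma IsRandomMatrix.measurable_trace (ha : IsRandomMatrix a) : Measurable fun ω => (a ω).trace :=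
  ha.measurable_comp continuous_id.matrix_trace

lemma isRandomMatrix_const (c : Mat d) : IsRandomMatrix fun _ : Ω => c :=
  fun _ _ => measurable_const

lemma IsRandomMatrix.add (ha : IsRandomMatrix a) (hb : IsRandomMatrix b) :
    IsRandomMatrix fun ω => a ω + b ω :=
  fun i j => (ha i j).add (hb i j)

lemma IsRandomMatrix.sub (ha : IsRandomMatrix a) (hb : IsRandomMatrix b) :
    IsRandomMatrix fun ω => a ω - b ω :=
  fun i j => (ha i j).sub (hb i j)

lemma IsRandomMatrix.smul {f : Ω → ℂ} (hf : Measurable f) (ha : IsRandomMatrix a) :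
    IsRandomMatrix fun ω => f ω • a ω :=
  fun i j => hf.mul (ha i j)

lemma IsRandomMatrix.mul (ha : IsRandomMatrix a) (hb : IsRandomMatrix b) :
    IsRandomMatrix fun ω => a ω * b ω := by
  intro i j
  simp only [mul_apply]
  exact Finset.measurable_sum _ fun k _ => (ha i k).mul (hb k j)

lemma IsRandomMatrix.pow (ha : IsRandomMatrix a) (n : ℕ) : IsRandomMatrix fun ω => a ω ^ n :=
  ha.comp_continuous (continuous_pow n)

lemma IsRandomMatrix.sum {ι : Type*} {s : Finset ι} {c : ι → Ω → Mat d}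
    (hc : ∀ k, IsRandomMatrix (c k)) : IsRandomMatrix fun ω => ∑ k ∈ s, c k ω := by
  intro i j
  simp only [Matrix.sum_apply]
  exact Finset.measurable_sum _ fun k _ => hc k i j

lemma IsRandomMatrix.conjTranspose (ha : IsRandomMatrix a) : IsRandomMatrix fun ω => (a ω)ᴴ :=
  ha.comp_continuous continuous_id.matrix_conjTranspose

lemma IsRandomMatrix.absMat (ha : IsRandomMatrix a) : IsRandomMatrix fun ω => absMat (a ω) :=
  ha.comp_continuous (continuous_absMat d)

lemma IsRandomMatrix.inv (ha : IsRandomMatrix a) : IsRandomMatrix fun ω => (a ω)⁻¹ := by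
  simp only [Matrix.inv_def, Ring.inverse_eq_inv']
  exact IsRandomMatrix.smul (ha.measurable_comp continuous_id.matrix_det).inv
    (ha.comp_continuous continuous_id.matrix_adjugate)

end RandomMatrix

/-! ### Ergodicity -/

section Ergodic

variable {Ω : Type*} [MeasurableSpace Ω] {μ : Measure Ω} {θ : Ω ≃ᵐ Ω}

lemma ae_comp {P : Ω → Prop} (hθ : Ergodic θ μ) (h : ∀ᵐ ω ∂μ, P ω) : ∀ᵐ ω ∂μ, P (θ ω) :=
  hθ.toMeasurePreserving.quasiMeasurePreserving.ae h

/-- A function that decreases along the orbits of a measure preserving transformation is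
invariant. -/
lemma ae_comp_eq_of_le [IsFiniteMeasure μ] (hθ : Ergodic θ μ) {f : Ω → ℝ} (hf : Measurable f)
    (h : ∀ᵐ ω ∂μ, f (θ ω) ≤ f ω) : ∀ᵐ ω ∂μ, f (θ ω) = f ω := by
  -- Each sublevel set lies a.e. in its preimage, which has the same finite measure, so the two
  -- agree a.e.
  have h1 (q : ℚ) : ∀ᵐ ω ∂μ, f (θ ω) < q → f ω < q := by
    have hs : MeasurableSet {ω | f ω < q} := measurableSet_lt hf measurable_const
    have hsub : {ω | f ω < q} ≤ᵐ[μ] θ ⁻¹' {ω | f ω < q} := by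
      filter_upwards [h] with ω hω hq
      exact lt_of_le_of_lt hω hq
    have := ae_eq_of_ae_subset_of_measure_ge hsub
      (hθ.toMeasurePreserving.measure_preimage hs.nullMeasurableSet).le
      hs.nullMeasurableSet (measure_ne_top _ _)
    filter_upwards [this] with ω hω hq
    exact (iff_of_eq hω).2 hq
  filter_upwards [h, ae_all_iff.2 h1] with ω hω hq
  refine le_antisymm hω (le_of_forall_gt_imp_ge_of_dense fun c hc => ?_)
  obtain ⟨q, hq1, hq2⟩ := exists_rat_btwn hc
  exact ((hq q hq1).trans hq2).le

lemma ae_eq_const_of_invariant (hθ : Ergodic θ μ) {f : Ω → ℂ} (hf : Measurable f)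
    (h : ∀ᵐ ω ∂μ, f (θ ω) = f ω) : ∃ c, ∀ᵐ ω ∂μ, f ω = c :=
  hθ.ae_eq_const_of_ae_eq_comp_ae hf.aestronglyMeasurable h

/-- The zero set is forward invariant, hence null or conull by ergodicity. -/
lemma ae_ne_zero_of_eigenfunction [IsFiniteMeasure μ] (hθ : Ergodic θ μ) {f : Ω → ℂ} (hf : Measurable f) {β : ℂ}
    (h : ∀ᵐ ω ∂μ, f (θ ω) = β * f ω) (h0 : ¬ ∀ᵐ ω ∂μ, f ω = 0) : ∀ᵐ ω ∂μ, f ω ≠ 0 := by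
  have hs : MeasurableSet {ω | f ω = 0} := hf (measurableSet_singleton 0)
  have hsub : {ω | f ω = 0} ≤ᵐ[μ] θ ⁻¹' {ω | f ω = 0} := by
    filter_upwards [h] with ω hω h0
    change f (θ ω) = 0
    rw [hω, show f ω = 0 from h0, mul_zero]
  rcases hθ.ae_empty_or_univ_of_ae_le_preimage hs.nullMeasurableSet hsub with h1 | h1
  · filter_upwards [h1] with ω hω hf0
    exact (iff_of_eq hω).1 hf0
  · refine absurd ?_ h0
    filter_upwards [h1] with ω hω
    exact (iff_of_eq hω).2 trivial

end Ergodic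

/-! ### Fixed points of irreducible processes -/

section FixedPoints

variable {Ω : Type*} [MeasurableSpace Ω] {μ : Measure Ω} {d : ℕ}
  {θ : Ω ≃ᵐ Ω} {φ : Ω → Mat d →ₗ[ℂ] Mat d}

/-- `y` is an eigenvector of the process for the eigenvalue `α`. -/
def IsEigen (μ : Measure Ω) (θ : Ω ≃ᵐ Ω) (φ : Ω → Mat d →ₗ[ℂ] Mat d) (α : ℂ)
    (y : Ω → Mat d) : Prop :=
  IsRandomMatrix y ∧ ∀ᵐ ω ∂μ, φ (θ ω) (y ω) = α • y (θ ω)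

lemma ae_channel (hproc : IsErgodicQuantumProcess μ θ φ) :
    ∀ᵐ ω ∂μ, IsQuantumChannel (φ (θ ω)) :=
  ae_comp hproc.1 hproc.2.2

lemma ae_conjTranspose (hproc : IsErgodicQuantumProcess μ θ φ) :
    ∀ᵐ ω ∂μ, ∀ a, φ (θ ω) aᴴ = (φ (θ ω) a)ᴴ := by
  filter_upwards [ae_channel hproc] with ω hω a
  obtain ⟨K, hK⟩ := hω.exists_isKraus
  exact hK.map_conjTranspose a

lemma ae_trace_invariant (hproc : IsErgodicQuantumProcess μ θ φ) {y : Ω → Mat d}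
    (hy : IsEigen μ θ φ 1 y) : ∀ᵐ ω ∂μ, (y (θ ω)).trace = (y ω).trace := by
  filter_upwards [ae_channel hproc, hy.2] with ω h1 h2
  rw [← h1.2 (y ω), h2, one_smul]

/-- A positive fixed point of an irreducible process vanishes or is faithful. -/
lemma ae_zero_or_isUnit [IsProbabilityMeasure μ] (hproc : IsErgodicQuantumProcess μ θ φ)
    (hirr : IsIrreducibleProcess μ θ φ) {m : Ω → Mat d} (hm : IsEigen μ θ φ 1 m)
    (hpos : ∀ᵐ ω ∂μ, (m ω).PosSemidef) : (∀ᵐ ω ∂μ, m ω = 0) ∨ ∀ᵐ ω ∂μ, IsUnit (m ω) := by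
  obtain ⟨c, hc⟩ := ae_eq_const_of_invariant hproc.1 hm.1.measurable_trace
    (ae_trace_invariant hproc hm)
  by_cases hc0 : c = 0
  · left
    filter_upwards [hc, hpos] with ω h1 h2
    exact h2.trace_eq_zero_iff.1 (h1.trans hc0)
  right
  -- `absMat (m ω)` is positive for every `ω`, whereas `m ω` is so only a.e. The choice of `p` is
  -- measurable because `p` is a pointwise limit of measurable maps.
  choose p s hp hpm hps hlim using fun ω => exists_support (absMat_posSemidef (m ω))
  have habs : ∀ᵐ ω ∂μ, absMat (m ω) = m ω := by
    filter_upwards [hpos] with ω hω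
    exact absMat_eq hω (by rw [hω.1.eq])
  have hrand : IsRandomMatrix p := by
    intro i j
    refine measurable_of_tendsto_metrizable (f := fun (n : ℕ) ω =>
      (absMat (m ω) * (absMat (m ω) + (((n : ℝ) + 1)⁻¹ : ℂ) • (1 : Mat d))⁻¹) i j) (fun n => ?_)
      (tendsto_pi_nhds.2 fun ω => hlim ω i j)
    exact hm.1.absMat.mul (hm.1.absMat.add (isRandomMatrix_const _)).inv i j
  have hproj : IsRandomProjection μ p := by
    refine ⟨hrand, ?_⟩
    filter_upwards [hc, habs] with ω h1 h2
    refine ⟨fun h0 => hc0 ?_, hp ω⟩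
    rw [← h1, ← h2, ← hpm ω, h0, Matrix.zero_mul, trace_zero]
  have hred : Reduces μ θ φ p := by
    filter_upwards [ae_channel hproc, habs, ae_comp hproc.1 habs, hm.2] with ω h1 h2 h3 h4
    obtain ⟨K, hK⟩ := h1.exists_isKraus
    refine hK.mapsTo_corner (absMat_posSemidef (m ω)) (hps ω) (hp ω) (hp (θ ω)) ?_
    rw [h2, h4, one_smul, ← h3, hpm]
  filter_upwards [hirr p hproj hred, habs] with ω h1 h2
  have h3 : m ω * s ω = 1 := by rw [← h2, ← hps, h1]
  exact IsUnit.of_mul_eq_one _ h3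

/-- The absolute value of a peripheral eigenvector is a fixed point. -/
lemma IsEigen.fixed_absMat [IsProbabilityMeasure μ] (hproc : IsErgodicQuantumProcess μ θ φ) {α : ℂ} (hα : ‖α‖ = 1)
    {x : Ω → Mat d} (hx : IsEigen μ θ φ α x) : IsEigen μ θ φ 1 fun ω => absMat (x ω) := by
  have hre (ω : Ω) : ((absMat (x ω)).trace.re : ℂ) = (absMat (x ω)).trace :=
    (Complex.eq_re_of_ofReal_le (r := 0)
      (by exact_mod_cast (absMat_posSemidef (x ω)).trace_nonneg)).symm
  have hinv : ∀ᵐ ω ∂μ, (absMat (x (θ ω))).trace.re = (absMat (x ω)).trace.re := by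
    refine ae_comp_eq_of_le (f := fun ω => (absMat (x ω)).trace.re) hproc.1
      (Complex.measurable_re.comp hx.1.absMat.measurable_trace) ?_
    filter_upwards [ae_channel hproc, hx.2] with ω h1 h2
    obtain ⟨K, hK⟩ := h1.exists_isKraus
    exact (Complex.le_def.1 (hK.trace_abs_le h1.2 hα h2)).1
  refine ⟨hx.1.absMat, ?_⟩
  filter_upwards [ae_channel hproc, hx.2, hinv] with ω h1 h2 h3
  obtain ⟨K, hK⟩ := h1.exists_isKraus
  rw [one_smul]
  exact hK.map_absMat h1.2 hα h2 (by rw [← hre, ← hre (ω := ω), h3])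

lemma IsEigen.add {α : ℂ} {x y : Ω → Mat d} (hx : IsEigen μ θ φ α x) (hy : IsEigen μ θ φ α y) :
    IsEigen μ θ φ α fun ω => x ω + y ω := by
  refine ⟨hx.1.add hy.1, ?_⟩
  filter_upwards [hx.2, hy.2] with ω h1 h2
  rw [map_add, h1, h2, smul_add]

lemma IsEigen.const_smul {α : ℂ} {x : Ω → Mat d} (hx : IsEigen μ θ φ α x) (c : ℂ) :
    IsEigen μ θ φ α fun ω => c • x ω := by
  refine ⟨hx.1.smul measurable_const, ?_⟩
  filter_upwards [hx.2] with ω h1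
  rw [map_smul, h1, smul_comm]

lemma IsEigen.conjTranspose (hproc : IsErgodicQuantumProcess μ θ φ) {x : Ω → Mat d}
    (hx : IsEigen μ θ φ 1 x) : IsEigen μ θ φ 1 fun ω => (x ω)ᴴ := by
  refine ⟨hx.1.conjTranspose, ?_⟩
  filter_upwards [hx.2, ae_conjTranspose hproc] with ω h1 h2
  rw [h2, h1, one_smul, one_smul]

/-- The positive fixed point `|z| + z` is zero or invertible, and its product with `|z| - z` is
zero. So `|z| = ± z`, and `|z|` has trace zero. -/
lemma ae_eq_zero_of_hermitian [IsProbabilityMeasure μ] (hproc : IsErgodicQuantumProcess μ θ φ)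
    (hirr : IsIrreducibleProcess μ θ φ) {z : Ω → Mat d} (hz : IsEigen μ θ φ 1 z)
    (hherm : ∀ᵐ ω ∂μ, (z ω).IsHermitian) (htr : ∀ᵐ ω ∂μ, (z ω).trace = 0) :
    ∀ᵐ ω ∂μ, z ω = 0 := by
  have habs := hz.fixed_absMat hproc (by simp)
  have hsq : ∀ᵐ ω ∂μ, (absMat (z ω) + z ω) * (absMat (z ω) + (-1 : ℂ) • z ω) = 0 := by
    filter_upwards [hherm] with ω hω
    have := commute_absMat_self hω
    have h2 := absMat_mul_self (z ω)
    rw [hω.eq] at h2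
    rw [neg_one_smul, Matrix.add_mul, Matrix.mul_add, Matrix.mul_add, Matrix.mul_neg,
      Matrix.mul_neg, this, h2]
    abel
  have hpos : ∀ᵐ ω ∂μ, (absMat (z ω) + z ω).PosSemidef := by
    filter_upwards [hherm] with ω hω using absMat_add_self_posSemidef hω
  have hfin : ∀ᵐ ω ∂μ, absMat (z ω) = z ω ∨ absMat (z ω) = - z ω := by
    rcases ae_zero_or_isUnit hproc hirr (habs.add hz) hpos with h | h
    · filter_upwards [h] with ω hω
      exact Or.inr (eq_neg_of_add_eq_zero_left hω)
    · filter_upwards [h, hsq] with ω h1 h2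
      have := h1.mul_right_eq_zero.1 h2
      rw [neg_one_smul, ← sub_eq_add_neg, sub_eq_zero] at this
      exact Or.inl this
  filter_upwards [hfin, htr] with ω h1 h2
  have h3 : absMat (z ω) = 0 := by
    rw [← (absMat_posSemidef (z ω)).trace_eq_zero_iff]
    rcases h1 with h1 | h1 <;> simp [h1, h2]
  rcases h1 with h1 | h1
  · rw [← h1, h3]
  · rw [← neg_eq_zero, ← h1, h3]

/-- Fixed points of an irreducible process are multiples of the steady state. -/
lemma IsEigen.eq_trace_smul [IsProbabilityMeasure μ] (hproc : IsErgodicQuantumProcess μ θ φ)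
    (hirr : IsIrreducibleProcess μ θ φ) {ϱ : Ω → Mat d} (hϱ : IsSteadyState μ θ φ ϱ)
    {y : Ω → Mat d} (hy : IsEigen μ θ φ 1 y) : ∀ᵐ ω ∂μ, y ω = (y ω).trace • ϱ ω := by
  set z : Ω → Mat d := fun ω => y ω - (y ω).trace • ϱ ω with hzdef
  have hz : IsEigen μ θ φ 1 z := by
    refine ⟨hy.1.sub (hϱ.1.1.smul hy.1.measurable_trace), ?_⟩
    filter_upwards [hy.2, hϱ.2, ae_trace_invariant hproc hy] with ω h1 h2 h3
    simp only [hzdef]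
    rw [map_sub, map_smul, h1, h2, h3, one_smul, one_smul]
  have htr : ∀ᵐ ω ∂μ, (z ω).trace = 0 := by
    filter_upwards [hϱ.1.2] with ω h1
    simp [hzdef, h1.2]
  have hz' := hz.conjTranspose hproc
  -- The real and imaginary parts of the traceless fixed point `z` vanish separately.
  have h1 := ae_eq_zero_of_hermitian hproc hirr (hz.add hz')
    (.of_forall fun ω => by
      rw [IsHermitian, conjTranspose_add, conjTranspose_conjTranspose, add_comm])
    (by filter_upwards [htr] with ω h; simp [h, trace_conjTranspose])
  have h2 := ae_eq_zero_of_hermitian hproc hirr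
    ((hz.const_smul Complex.I).add (hz'.const_smul (-Complex.I)))
    (.of_forall fun ω => by
      rw [IsHermitian, conjTranspose_add, conjTranspose_smul, conjTranspose_smul,
        conjTranspose_conjTranspose, add_comm]
      simp)
    (by filter_upwards [htr] with ω h; simp [h, trace_conjTranspose])
  filter_upwards [h1, h2] with ω h1 h2
  have h3 : z ω = (2⁻¹ : ℂ) • ((z ω + (z ω)ᴴ) -
      Complex.I • (Complex.I • z ω + (-Complex.I) • (z ω)ᴴ)) := by
    simp only [smul_add, smul_smul, mul_neg, Complex.I_mul_I]
    module
  rw [h1, h2] at h3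
  simpa [hzdef, sub_eq_zero] using h3

lemma ae_isUnit_steadyState [IsProbabilityMeasure μ] (hproc : IsErgodicQuantumProcess μ θ φ)
    (hirr : IsIrreducibleProcess μ θ φ) {ϱ : Ω → Mat d} (hϱ : IsSteadyState μ θ φ ϱ) :
    ∀ᵐ ω ∂μ, IsUnit (ϱ ω) := by
  refine (ae_zero_or_isUnit hproc hirr ⟨hϱ.1.1, ?_⟩ ?_).resolve_left fun h => ?_
  · filter_upwards [hϱ.2] with ω h using by rw [h, one_smul]
  · filter_upwards [hϱ.1.2] with ω h using h.1
  · obtain ⟨ω, h1, h2⟩ := (h.and hϱ.1.2).exists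
    have := h2.2
    simp [h1] at this

/-- A peripheral eigenvalue is implemented by a random unitary commuting with the steady state. -/
lemma exists_random_unitary [IsProbabilityMeasure μ] (hproc : IsErgodicQuantumProcess μ θ φ)
    (hirr : IsIrreducibleProcess μ θ φ) {ϱ : Ω → Mat d} (hϱ : IsSteadyState μ θ φ ϱ) {α : ℂ}
    (hα : α ∈ peripheralEigenvalues μ θ φ) :
    ∃ u : Ω → Mat d, IsRandomMatrix u ∧ (∀ᵐ ω ∂μ, (u ω)ᴴ * u ω = 1) ∧
      (∀ᵐ ω ∂μ, u ω * ϱ ω = ϱ ω * u ω) ∧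
      ∀ᵐ ω ∂μ, ∀ a, φ (θ ω) (u ω * a) = α • (u (θ ω) * φ (θ ω) a) := by
  obtain ⟨⟨x, hxr, hx0, hx⟩, hα1⟩ := hα
  have hxe : IsEigen μ θ φ α x := ⟨hxr, hx⟩
  have habs := hxe.fixed_absMat hproc hα1
  obtain ⟨c, hc⟩ := ae_eq_const_of_invariant hproc.1 habs.1.measurable_trace
    (ae_trace_invariant hproc habs)
  have hc0 : c ≠ 0 := by
    rintro rfl
    refine hx0 ?_
    filter_upwards [hc] with ω h
    obtain ⟨w, -, hw⟩ := exists_polar (x ω)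
    rw [hw, (absMat_posSemidef (x ω)).trace_eq_zero_iff.1 h, Matrix.mul_zero]
  have hunit := ae_isUnit_steadyState hproc hirr hϱ
  have hdens := hϱ.1.2
  -- As `|x| = c • ϱ`, the polar decomposition reads `x = c • (w * ϱ)`. Solving for `w` gives a
  -- measurable formula.
  set u : Ω → Mat d := fun ω => c⁻¹ • (x ω * (ϱ ω)⁻¹) with hu
  have hur : IsRandomMatrix u := (hxr.mul hϱ.1.1.inv).smul measurable_const
  have hux : ∀ᵐ ω ∂μ, u ω * ϱ ω = c⁻¹ • x ω := by
    filter_upwards [hunit] with ω h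
    rw [hu, Matrix.smul_mul, Matrix.mul_assoc,
      Matrix.nonsing_inv_mul _ ((Matrix.isUnit_iff_isUnit_det _).1 h), Matrix.mul_one]
  have huu : ∀ᵐ ω ∂μ, (u ω)ᴴ * u ω = 1 := by
    filter_upwards [hunit, hux, habs.eq_trace_smul hproc hirr hϱ, hc] with ω h1 h2 h3 h4
    obtain ⟨w, hw, hxw⟩ := exists_polar (x ω)
    have : u ω = w := by
      refine h1.mul_left_injective ?_
      change u ω * ϱ ω = w * ϱ ω
      rw [h2, hxw, h3, h4, Matrix.mul_smul, smul_smul, inv_mul_cancel₀ hc0, one_smul]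
    rw [this, hw]
  have hmul : ∀ᵐ ω ∂μ, ∀ a, φ (θ ω) (u ω * a) = α • (u (θ ω) * φ (θ ω) a) := by
    filter_upwards [ae_channel hproc, huu, ae_comp hproc.1 huu, hux, ae_comp hproc.1 hux, hunit,
      hdens, ae_comp hproc.1 hdens, hx] with ω h1 h2 h3 h4 h5 h6 h7 h8 h9
    obtain ⟨K, hK⟩ := h1.exists_isKraus
    refine hK.map_unitary_mul h1.2 hα1 h2 h3 h7.1 h8.1.1 h6 ?_ (by rw [h7.2, h8.2])
    rw [h4, h5, map_smul, h9, smul_comm]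
  refine ⟨u, hur, huu, ?_, hmul⟩
  -- The factors `α` and `star α` from the two sides cancel. This fixed point has trace one, so it
  -- equals `ϱ`.
  have hfix : IsEigen μ θ φ 1 fun ω => u ω * ϱ ω * (u ω)ᴴ := by
    refine ⟨(hur.mul hϱ.1.1).mul hur.conjTranspose, ?_⟩
    filter_upwards [hmul, ae_conjTranspose hproc, hϱ.2, hdens, ae_comp hproc.1 hdens]
      with ω h1 h2 h3 h4 h5
    have h6 : ϱ ω * (u ω)ᴴ = (u ω * ϱ ω)ᴴ := by rw [conjTranspose_mul, h4.1.1.eq]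
    rw [Matrix.mul_assoc, h1, h6, h2, h1, h3, conjTranspose_smul, conjTranspose_mul, h5.1.1.eq,
      Matrix.mul_smul, smul_smul, Complex.star_def, Complex.mul_conj', hα1, Matrix.mul_assoc]
    simp
  filter_upwards [hfix.eq_trace_smul hproc hirr hϱ, huu, hdens] with ω h1 h2 h3
  rw [trace_unitary_conj h2, h3.2, one_smul] at h1
  conv_rhs => rw [← h1]
  rw [Matrix.mul_assoc, h2, Matrix.mul_one]

end FixedPoints

/-! ### Spectral projections of unitaries of finite order -/

/-- Otherwise pairing the Cayley-Hamilton identity for `u` with `ρ` would leave only the constant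
term, which is `± det u` and nonzero. -/
lemma exists_trace_pow_mul_ne_zero {d : ℕ} {u ρ : Mat d} (hu : uᴴ * u = 1) (hρ : ρ.trace = 1) :
    ∃ n : ℕ, 0 < n ∧ (u ^ n * ρ).trace ≠ 0 := by
  by_contra! h
  have h1 : ((Polynomial.aeval u u.charpoly) * ρ).trace = 0 := by
    rw [aeval_self_charpoly, Matrix.zero_mul, trace_zero]
  rw [Polynomial.aeval_eq_sum_range, Finset.sum_mul, trace_sum,
    Finset.sum_eq_single_of_mem 0 (by simp)] at h1
  · rw [pow_zero, Matrix.smul_mul, Matrix.one_mul, trace_smul, hρ, smul_eq_mul, mul_one] at h1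
    have h2 : u.det = 0 := by rw [det_eq_sign_charpoly_coeff, h1, mul_zero]
    have h3 := congrArg det hu
    rw [det_mul, h2, mul_zero, det_one] at h3
    exact zero_ne_one h3
  · intro n _ hn
    rw [Matrix.smul_mul, trace_smul, h n (Nat.pos_of_ne_zero hn), smul_zero]

section SpectralProjection

variable {d N : ℕ} [NeZero N]

/-- The spectral projection of a matrix `v` with `v ^ N = 1` for the eigenvalue
`exp (2 π i k / N)`. -/
noncomputable def spectralProj (v : Mat d) (k : ZMod N) : Mat d :=
  (N : ℂ)⁻¹ • ∑ j : ZMod N, ZMod.stdAddChar (-(j * k)) • v ^ j.val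

lemma pow_val_add {v : Mat d} (hv : v ^ N = 1) (i j : ZMod N) :
    v ^ (i + j).val = v ^ i.val * v ^ j.val := by
  rw [ZMod.val_add, ← pow_eq_pow_mod _ hv, pow_add]

lemma sum_stdAddChar_mul (b : ZMod N) :
    ∑ j : ZMod N, ZMod.stdAddChar (j * b) = if b = 0 then (N : ℂ) else 0 := by
  rw [AddChar.sum_mulShift b (ZMod.isPrimitive_stdAddChar N), ZMod.card]
  split_ifs <;> simp

lemma natCast_ne_zero_of_neZero : (N : ℂ) ≠ 0 := Nat.cast_ne_zero.2 (NeZero.ne N)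

lemma pow_mul_spectralProj {v : Mat d} (hv : v ^ N = 1) (i k : ZMod N) :
    v ^ i.val * spectralProj v k = ZMod.stdAddChar (i * k) • spectralProj v k := by
  have h : v ^ i.val * ∑ j : ZMod N, (ZMod.stdAddChar (-(j * k)) : ℂ) • v ^ j.val =
      (ZMod.stdAddChar (i * k) : ℂ) •
        ∑ j : ZMod N, (ZMod.stdAddChar (-(j * k)) : ℂ) • v ^ j.val := by
    rw [Finset.mul_sum, Finset.smul_sum]
    refine Fintype.sum_equiv (Equiv.addLeft i) _ _ fun j => ?_
    rw [Equiv.coe_addLeft, pow_val_add hv, Matrix.mul_smul, smul_smul, ← AddChar.map_add_eq_mul]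
    congr 2
    ring
  rw [spectralProj, Matrix.mul_smul, h, smul_comm]

lemma spectralProj_mul {v : Mat d} (hv : v ^ N = 1) (l k : ZMod N) :
    spectralProj v l * spectralProj v k = if k = l then spectralProj v k else 0 := by
  conv_lhs => rw [spectralProj]
  rw [Matrix.smul_mul, Finset.sum_mul]
  have h (j : ZMod N) : (ZMod.stdAddChar (-(j * l)) • v ^ j.val) * spectralProj v k =
      ZMod.stdAddChar (j * (k - l)) • spectralProj v k := by
    rw [Matrix.smul_mul, pow_mul_spectralProj hv, smul_smul, ← AddChar.map_add_eq_mul]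
    congr 2
    ring
  simp only [h]
  rw [← Finset.sum_smul (M := Mat d), sum_stdAddChar_mul]
  simp only [sub_eq_zero]
  split_ifs
  · rw [smul_smul, inv_mul_cancel₀ natCast_ne_zero_of_neZero, one_smul]
  · simp

lemma sum_spectralProj (v : Mat d) : ∑ k : ZMod N, spectralProj v k = 1 := by
  simp only [spectralProj]
  rw [← Finset.smul_sum, Finset.sum_comm]
  have h (j : ZMod N) : ∑ k : ZMod N, (ZMod.stdAddChar (-(j * k)) : ℂ) • v ^ j.val =
      if j = 0 then (N : ℂ) • 1 else 0 := by
    have h1 (k : ZMod N) : -(j * k) = k * (-j) := by ring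
    simp only [h1]
    rw [← Finset.sum_smul, sum_stdAddChar_mul]
    simp only [neg_eq_zero]
    split_ifs with h0
    · simp [h0]
    · simp
  simp only [h]
  rw [Finset.sum_ite_eq' Finset.univ (0 : ZMod N), if_pos (Finset.mem_univ _), smul_smul,
    inv_mul_cancel₀ natCast_ne_zero_of_neZero, one_smul]

lemma conjTranspose_mul_self_pow {v : Mat d} (hv : vᴴ * v = 1) (n : ℕ) :
    (v ^ n)ᴴ * v ^ n = 1 := by
  induction n with
  | zero => simp
  | succ n ih =>
    rw [pow_succ, conjTranspose_mul, Matrix.mul_assoc, ← Matrix.mul_assoc _ _ v, ih,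
      Matrix.one_mul, hv]

lemma isStarProjection_spectralProj {v : Mat d} (hv : v ^ N = 1) (hu : vᴴ * v = 1) (k : ZMod N) :
    IsStarProjection (spectralProj v k) := by
  refine ⟨?_, ?_⟩
  · rw [IsIdempotentElem, spectralProj_mul hv, if_pos rfl]
  · have hadj (j : ZMod N) : (v ^ j.val)ᴴ = v ^ (-j).val := by
      have h1 : v ^ j.val * v ^ (-j).val = 1 := by
        rw [← pow_val_add hv, add_neg_cancel, ZMod.val_zero, pow_zero]
      rw [← Matrix.mul_one (v ^ j.val)ᴴ, ← h1, ← Matrix.mul_assoc,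
        conjTranspose_mul_self_pow hu, Matrix.one_mul]
    rw [IsSelfAdjoint, star_eq_conjTranspose, spectralProj, conjTranspose_smul, conjTranspose_sum]
    have hN : star (N : ℂ)⁻¹ = (N : ℂ)⁻¹ := by simp
    rw [hN]
    congr 1
    refine Fintype.sum_equiv (Equiv.neg _) _ _ fun j => ?_
    rw [conjTranspose_smul, hadj, Equiv.neg_apply, Complex.star_def, ← AddChar.map_neg_eq_conj]
    congr 2
    ring

lemma isRandomMatrix_spectralProj {Ω : Type*} [MeasurableSpace Ω] {v : Ω → Mat d}
    (hv : IsRandomMatrix v) (k : ZMod N) : IsRandomMatrix fun ω => spectralProj (v ω) k :=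
  (IsRandomMatrix.sum fun _ => (hv.pow _).smul measurable_const).smul measurable_const

lemma trace_spectralProj_mul {v ρ : Mat d} (hρ : ρ.trace = 1)
    (h : ∀ n : ℕ, 0 < n → n < N → (v ^ n * ρ).trace = 0) (k : ZMod N) :
    (spectralProj v k * ρ).trace = (N : ℂ)⁻¹ := by
  rw [spectralProj, Matrix.smul_mul, trace_smul, Finset.sum_mul, trace_sum,
    Finset.sum_eq_single_of_mem 0 (Finset.mem_univ _)]
  · simp [hρ]
  · intro j _ hj
    rw [Matrix.smul_mul, trace_smul, h _ (ZMod.val_pos.2 hj) (ZMod.val_lt j), smul_zero]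

lemma spectralProj_ne_zero {v ρ : Mat d} {k : ZMod N}
    (h : (spectralProj v k * ρ).trace = (N : ℂ)⁻¹) : spectralProj v k ≠ 0 := by
  intro h0
  rw [h0, Matrix.zero_mul, trace_zero] at h
  exact inv_ne_zero natCast_ne_zero_of_neZero h.symm

lemma commute_spectralProj {v ρ : Mat d} (h : v * ρ = ρ * v) (k : ZMod N) :
    spectralProj v k * ρ = ρ * spectralProj v k := by
  rw [spectralProj, Matrix.smul_mul, Matrix.mul_smul, Finset.sum_mul, Finset.mul_sum]
  congr 1
  refine Finset.sum_congr rfl fun j _ => ?_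
  rw [Matrix.smul_mul, Matrix.mul_smul]
  congr 1
  exact (Commute.pow_left h _).eq

lemma map_pow_mul {ψ : Mat d →ₗ[ℂ] Mat d} {v w : Mat d} {c : ℂ}
    (h : ∀ a, ψ (v * a) = c • (w * ψ a)) (n : ℕ) (a : Mat d) :
    ψ (v ^ n * a) = c ^ n • (w ^ n * ψ a) := by
  induction n generalizing a with
  | zero => simp
  | succ n ih =>
    rw [pow_succ, Matrix.mul_assoc, ih, h, Matrix.mul_smul, smul_smul, pow_succ, pow_succ,
      Matrix.mul_assoc]

/-- The multiplier contributes the character value at `j * s` to the `j`-th Fourier term, which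
shifts the frequency `k` to `k - s`. -/
lemma map_spectralProj_mul {ψ : Mat d →ₗ[ℂ] Mat d} {v w : Mat d} {s : ZMod N}
    (h : ∀ a, ψ (v * a) = (ZMod.stdAddChar s : ℂ) • (w * ψ a)) (k : ZMod N) (a : Mat d) :
    ψ (spectralProj v k * a) = spectralProj w (k - s) * ψ a := by
  simp only [spectralProj, Matrix.smul_mul, map_smul, Finset.sum_mul, map_sum]
  congr 1
  refine Finset.sum_congr rfl fun j _ => ?_
  rw [map_pow_mul h, smul_smul, ← AddChar.map_nsmul_eq_pow, ← AddChar.map_add_eq_mul]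
  congr 2
  rw [nsmul_eq_mul, ZMod.natCast_zmod_val]
  ring

lemma mapsTo_corner_spectralProj {ψ : Mat d →ₗ[ℂ] Mat d} (hψ : ∀ a, ψ aᴴ = (ψ a)ᴴ)
    {v w : Mat d} (hv : v ^ N = 1) (hvu : vᴴ * v = 1) (hw : w ^ N = 1) (hwu : wᴴ * w = 1)
    {s : ZMod N} (h : ∀ a, ψ (v * a) = (ZMod.stdAddChar s : ℂ) • (w * ψ a)) (k : ZMod N) :
    Set.MapsTo ψ (corner (spectralProj v k)) (corner (spectralProj w (k - s))) := by
  have h1 : (spectralProj v k)ᴴ = spectralProj v k :=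
    (isStarProjection_spectralProj hv hvu k).isSelfAdjoint
  have h2 : (spectralProj w (k - s))ᴴ = spectralProj w (k - s) :=
    (isStarProjection_spectralProj hw hwu (k - s)).isSelfAdjoint
  rintro _ ⟨a, rfl⟩
  refine ⟨ψ a, ?_⟩
  have h3 : a * spectralProj v k = (spectralProj v k * aᴴ)ᴴ := by
    rw [conjTranspose_mul, conjTranspose_conjTranspose, h1]
  rw [Matrix.mul_assoc, map_spectralProj_mul h, h3, hψ, map_spectralProj_mul h, conjTranspose_mul,
    hψ, conjTranspose_conjTranspose, h2, Matrix.mul_assoc]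

/-- The discrete logarithm of an `N`-th root of unity. -/
noncomputable def rootLog (N : ℕ) [NeZero N] (z : ℂ) : ZMod N :=
  -- At most one summand is nonzero since the character is injective. The value off the roots of
  -- unity is `0`.
  open scoped Classical in ∑ k : ZMod N, if z = ZMod.stdAddChar k then k else 0

lemma measurable_rootLog : Measurable (rootLog N) := by
  classical
  unfold rootLog
  refine Finset.measurable_sum _ fun k _ => ?_
  exact Measurable.ite (p := fun z : ℂ => z = ZMod.stdAddChar k)
    (measurableSet_singleton (ZMod.stdAddChar k : ℂ)) measurable_const measurable_const

lemma stdAddChar_rootLog {z : ℂ} (hz : z ^ N = 1) : ZMod.stdAddChar (rootLog N z) = z := by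
  classical
  obtain ⟨i, -, hi⟩ := (Complex.isPrimitiveRoot_exp N (NeZero.ne N)).eq_pow_of_pow_eq_one hz
  have h1 : (ZMod.stdAddChar ((i : ℤ) : ZMod N) : ℂ) = z := by
    rw [ZMod.stdAddChar_coe, ← hi, ← Complex.exp_nat_mul]
    congr 1
    push_cast
    ring
  have h2 : rootLog N z = ((i : ℤ) : ZMod N) := by
    unfold rootLog
    rw [Finset.sum_eq_single_of_mem _ (Finset.mem_univ ((i : ℤ) : ZMod N)), if_pos h1.symm]
    intro k _ hk
    refine if_neg fun h => hk (ZMod.injective_stdAddChar ?_)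
    rw [← h, h1]
  rw [h2, h1]

end SpectralProjection

/-! ### Traces of powers of the unitary, and the period. -/

section Period

variable {Ω : Type*} [MeasurableSpace Ω] {μ : Measure Ω} {d : ℕ}
  {θ : Ω ≃ᵐ Ω} {φ : Ω → Mat d →ₗ[ℂ] Mat d} {ϱ u : Ω → Mat d} {α : ℂ}

lemma ae_trace_pow_mul (hproc : IsErgodicQuantumProcess μ θ φ) (hϱ : IsSteadyState μ θ φ ϱ)
    (hmul : ∀ᵐ ω ∂μ, ∀ a, φ (θ ω) (u ω * a) = α • (u (θ ω) * φ (θ ω) a)) (n : ℕ) :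
    ∀ᵐ ω ∂μ, (u ω ^ n * ϱ ω).trace = α ^ n * (u (θ ω) ^ n * ϱ (θ ω)).trace := by
  filter_upwards [ae_channel hproc, hmul, hϱ.2] with ω h1 h2 h3
  rw [← h1.2 (u ω ^ n * ϱ ω), map_pow_mul h2, h3, trace_smul, smul_eq_mul]

/-- The trace acquires the factor `α⁻ⁿ` along `θ`, which is the conjugate of `α ^ n`. Hence its
complex conjugate is the eigenfunction. -/
lemma pow_mem_thetaEigenvalues (hproc : IsErgodicQuantumProcess μ θ φ)
    (hϱ : IsSteadyState μ θ φ ϱ) (hα : ‖α‖ = 1) (hu : IsRandomMatrix u)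
    (hmul : ∀ᵐ ω ∂μ, ∀ a, φ (θ ω) (u ω * a) = α • (u (θ ω) * φ (θ ω) a)) {n : ℕ}
    (hn : ¬ ∀ᵐ ω ∂μ, (u ω ^ n * ϱ ω).trace = 0) : α ^ n ∈ thetaEigenvalues μ θ := by
  refine ⟨fun ω => star (u ω ^ n * ϱ ω).trace, ?_, fun h => hn ?_, ?_⟩
  · exact Complex.continuous_conj.measurable.comp ((hu.pow n).mul hϱ.1.1).measurable_trace
  · filter_upwards [h] with ω hω
    exact star_eq_zero.1 hω
  · filter_upwards [ae_trace_pow_mul hproc hϱ hmul n] with ω hω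
    rw [hω, star_mul', ← mul_assoc, Complex.star_def, Complex.mul_conj', norm_pow, hα]
    simp

/-- If `α ^ n` is an eigenvalue of the base then the `n`-th power of the unitary is scalar. -/
lemma ae_pow_eq_smul_one [IsProbabilityMeasure μ] (hproc : IsErgodicQuantumProcess μ θ φ)
    (hirr : IsIrreducibleProcess μ θ φ) (hϱ : IsSteadyState μ θ φ ϱ)
    (hu : IsRandomMatrix u)
    (hmul : ∀ᵐ ω ∂μ, ∀ a, φ (θ ω) (u ω * a) = α • (u (θ ω) * φ (θ ω) a)) {n : ℕ}
    (hn : α ^ n ∈ thetaEigenvalues μ θ) :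
    ∀ᵐ ω ∂μ, u ω ^ n = (u ω ^ n * ϱ ω).trace • (1 : Mat d) := by
  obtain ⟨g, hg, hg0, hgθ⟩ := hn
  -- The factor `α ^ n` produced by the channel is absorbed by `g (θ ω) = α ^ n * g ω`.
  have hfix : IsEigen μ θ φ 1 fun ω => g ω • (u ω ^ n * ϱ ω) := by
    refine ⟨((hu.pow n).mul hϱ.1.1).smul hg, ?_⟩
    filter_upwards [hmul, hϱ.2, hgθ] with ω h1 h2 h3
    rw [map_smul, map_pow_mul h1, h2, h3, smul_smul, one_smul, mul_comm]
  filter_upwards [hfix.eq_trace_smul hproc hirr hϱ, ae_ne_zero_of_eigenfunction hproc.1 hg hgθ hg0,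
    ae_isUnit_steadyState hproc hirr hϱ] with ω h1 h2 h3
  rw [trace_smul, smul_assoc] at h1
  refine h3.mul_left_injective ?_
  change _ * ϱ ω = _ * ϱ ω
  rw [Matrix.smul_mul, Matrix.one_mul]
  exact smul_right_injective _ h2 h1

lemma exists_isPeriod [IsProbabilityMeasure μ] (hproc : IsErgodicQuantumProcess μ θ φ)
    (hϱ : IsSteadyState μ θ φ ϱ) (hα : ‖α‖ = 1) (hu : IsRandomMatrix u)
    (huu : ∀ᵐ ω ∂μ, (u ω)ᴴ * u ω = 1)
    (hmul : ∀ᵐ ω ∂μ, ∀ a, φ (θ ω) (u ω * a) = α • (u (θ ω) * φ (θ ω) a)) :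
    ∃ N, IsPeriod μ θ α N := by
  have hne : {n : ℕ | 0 < n ∧ α ^ n ∈ thetaEigenvalues μ θ}.Nonempty := by
    by_contra h
    have h1 (n : ℕ) : ∀ᵐ ω ∂μ, 0 < n → (u ω ^ n * ϱ ω).trace = 0 := by
      by_cases hn : 0 < n
      · have : ∀ᵐ ω ∂μ, (u ω ^ n * ϱ ω).trace = 0 := by
          by_contra h2
          exact h ⟨n, hn, pow_mem_thetaEigenvalues hproc hϱ hα hu hmul h2⟩
        filter_upwards [this] with ω hω _ using hω
      · exact .of_forall fun _ h => absurd h hn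
    obtain ⟨ω, h2, h3, h4⟩ := ((ae_all_iff.2 h1).and (huu.and hϱ.1.2)).exists
    obtain ⟨n, hn, hn0⟩ := exists_trace_pow_mul_ne_zero h3 h4.2
    exact hn0 (h2 n hn)
  exact ⟨sInf _, Nat.sInf_mem hne, fun _ h => Nat.sInf_le h⟩

end Period

end QuantumProcess

/-! ### The cyclic decomposition. -/

theorem theorem2 {Ω : Type*} [MeasurableSpace Ω] (μ : Measure Ω) [IsProbabilityMeasure μ]
    {d : ℕ} (θ : Ω ≃ᵐ Ω) (φ : Ω → Mat d →ₗ[ℂ] Mat d)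
    (hproc : IsErgodicQuantumProcess μ θ φ) (hirr : IsIrreducibleProcess μ θ φ)
    (ϱ : Ω → Mat d) (hϱ : IsSteadyState μ θ φ ϱ)
    (α : ℂ) (hα : α ∈ peripheralEigenvalues μ θ φ) :
    ∃ (N : ℕ) (_ : NeZero N), IsPeriod μ θ α N ∧
      ∃ (p : ZMod N → Ω → Mat d) (ς : Ω → ZMod N),
        IsRandomPartitionOfUnity μ p ∧ Measurable ς ∧
        (∀ᵐ ω ∂μ, ∀ k : ZMod N,
          Set.MapsTo (φ (θ ω)) (corner (p k ω)) (corner (p (k - ς ω) (θ ω)))) ∧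
        ∀ᵐ ω ∂μ, ϱ ω = (N : ℂ)⁻¹ • ∑ k : ZMod N,
          ((p k ω * ϱ ω * p k ω).trace)⁻¹ • (p k ω * ϱ ω * p k ω) := by
  obtain ⟨u, hur, huu, hcomm, hmul⟩ := exists_random_unitary hproc hirr hϱ hα
  have hα1 := hα.2
  obtain ⟨N, hN⟩ := exists_isPeriod hproc hϱ hα1 hur huu hmul
  have hN0 : NeZero N := ⟨hN.1.1.ne'⟩
  -- A nonzero trace would contradict the minimality of `N`.
  have hlt : ∀ᵐ ω ∂μ, ∀ n : ℕ, 0 < n → n < N → (u ω ^ n * ϱ ω).trace = 0 := by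
    refine ae_all_iff.2 fun n => ?_
    by_cases hn : 0 < n ∧ n < N
    · have : ∀ᵐ ω ∂μ, (u ω ^ n * ϱ ω).trace = 0 := by
        by_contra h
        exact hn.2.not_ge (hN.2 ⟨hn.1, pow_mem_thetaEigenvalues hproc hϱ hα1 hur hmul h⟩)
      filter_upwards [this] with ω hω _ _ using hω
    · exact .of_forall fun _ h1 h2 => absurd ⟨h1, h2⟩ hn
  set f : Ω → ℂ := fun ω => (u ω ^ N * ϱ ω).trace with hf
  have hscalar : ∀ᵐ ω ∂μ, u ω ^ N = f ω • (1 : Mat d) :=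
    ae_pow_eq_smul_one hproc hirr hϱ hur hmul hN.1.2
  have hfθ : ∀ᵐ ω ∂μ, f ω = α ^ N * f (θ ω) := ae_trace_pow_mul hproc hϱ hmul N
  -- The principal root is measurable but need not be compatible with `θ`. The discrepancy makes the
  -- shift `ς` depend on `ω`.
  set η : Ω → ℂ := fun ω => f ω ^ ((N : ℂ)⁻¹) with hη
  have hηm : Measurable η := ((hur.pow N).mul hϱ.1.1).measurable_trace.pow_const _
  have hηN (ω : Ω) : η ω ^ N = f ω := Complex.cpow_nat_inv_pow _ (NeZero.ne N)
  have hη1 : ∀ᵐ ω ∂μ, ‖η ω‖ = 1 := by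
    filter_upwards [hscalar, huu, hϱ.1.2] with ω h1 h2 h3
    have h4 := conjTranspose_mul_self_pow h2 N
    rw [h1, conjTranspose_smul, conjTranspose_one, Matrix.smul_mul, Matrix.one_mul, smul_smul,
      Complex.star_def, Complex.conj_mul'] at h4
    have h5 := congrArg (fun m : Mat d => (m * ϱ ω).trace) h4
    simp only [Matrix.smul_mul, Matrix.one_mul, trace_smul, h3.2, smul_eq_mul, mul_one] at h5
    have h6 : ‖f ω‖ = 1 := by
      have : ‖f ω‖ ^ 2 = 1 := by exact_mod_cast h5
      exact (pow_eq_one_iff_of_nonneg (norm_nonneg _) two_ne_zero).1 this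
    rw [← hηN, norm_pow] at h6
    exact (pow_eq_one_iff_of_nonneg (norm_nonneg _) (NeZero.ne N)).1 h6
  set v : Ω → Mat d := fun ω => (η ω)⁻¹ • u ω with hv
  have hvr : IsRandomMatrix v := hur.smul hηm.inv
  have hη0 : ∀ᵐ ω ∂μ, η ω ≠ 0 := by
    filter_upwards [hη1] with ω h h0
    simp [h0] at h
  have hvN : ∀ᵐ ω ∂μ, v ω ^ N = 1 := by
    filter_upwards [hscalar, hη0] with ω h1 h2
    rw [hv, smul_pow, h1, inv_pow, hηN, smul_smul, ← hηN, inv_mul_cancel₀ (pow_ne_zero _ h2),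
      one_smul]
  have hvu : ∀ᵐ ω ∂μ, (v ω)ᴴ * v ω = 1 := by
    filter_upwards [huu, hη1] with ω h1 h2
    rw [hv, conjTranspose_smul, Matrix.smul_mul, Matrix.mul_smul, h1, smul_smul, Complex.star_def,
      Complex.conj_mul', norm_inv, h2]
    simp
  have htr : ∀ᵐ ω ∂μ, ∀ k : ZMod N, (spectralProj (v ω) k * ϱ ω).trace = (N : ℂ)⁻¹ := by
    filter_upwards [hlt, hϱ.1.2] with ω h1 h2 k
    refine trace_spectralProj_mul h2.2 (fun n hn hnN => ?_) k
    rw [hv, smul_pow, Matrix.smul_mul, trace_smul, h1 n hn hnN, smul_zero]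
  refine ⟨N, hN0, hN, fun k ω => spectralProj (v ω) k,
    fun ω => rootLog N (α * (η (θ ω) / η ω)), ⟨fun k => ⟨isRandomMatrix_spectralProj hvr k, ?_⟩, ?_⟩,
    measurable_rootLog.comp (((hηm.comp θ.measurable).div hηm).const_mul α), ?_, ?_⟩
  · filter_upwards [hvN, hvu, htr] with ω h1 h2 h3
    exact ⟨spectralProj_ne_zero (h3 k), isStarProjection_spectralProj h1 h2 k⟩
  · filter_upwards [hvN, hvu, htr] with ω h1 h2 h3
    refine ⟨fun k => ⟨spectralProj_ne_zero (h3 k), isStarProjection_spectralProj h1 h2 k⟩,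
      sum_spectralProj _, fun k j hkj => ?_⟩
    rw [spectralProj_mul h1, if_neg hkj.symm]
  · filter_upwards [hvN, hvu, ae_comp hproc.1 hvN, ae_comp hproc.1 hvu, ae_conjTranspose hproc,
      hmul, hfθ, hη0, ae_comp hproc.1 hη0] with ω h1 h2 h3 h4 h5 h6 h7 h8 h9 k
    refine mapsTo_corner_spectralProj h5 h1 h2 h3 h4 (fun a => ?_) k
    have hroot : (α * (η (θ ω) / η ω)) ^ N = 1 := by
      rw [mul_pow, div_pow, hηN, hηN, mul_div_assoc', ← h7, ← hηN]
      exact div_self (pow_ne_zero _ h8)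
    rw [stdAddChar_rootLog hroot]
    simp only [hv, Matrix.smul_mul, map_smul, h6, smul_smul]
    congr 1
    field_simp
  · filter_upwards [hvN, htr, hcomm] with ω h1 h2 h3
    -- The projections commute with `ϱ`, so the weights `1 / N` cancel and the sum collapses to `(∑
    -- k, p k) * ϱ = ϱ`.
    have h4 (k : ZMod N) : spectralProj (v ω) k * ϱ ω * spectralProj (v ω) k =
        spectralProj (v ω) k * ϱ ω := by
      have : v ω * ϱ ω = ϱ ω * v ω := by
        rw [hv, Matrix.smul_mul, Matrix.mul_smul, h3]
      rw [Matrix.mul_assoc, ← commute_spectralProj this, ← Matrix.mul_assoc,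
        spectralProj_mul h1, if_pos rfl]
    simp only [h4, h2, inv_inv]
    rw [← Finset.smul_sum, smul_smul, inv_mul_cancel₀ natCast_ne_zero_of_neZero, one_smul, ← Finset.sum_mul,
      sum_spectralProj, Matrix.one_mul]
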